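/- Let $\mathcal A$ and $\mathcal B$ be von Neumann algebras (acting on complex Hilbert spaces) and let $\Phi:\mathcal A\to\mathcal B$ be a positive linear map which is tracial, that is, $\Phi(XY)=\Phi(YX)$ for all $X,Y\in\mathcal A$. Let $\rho\in\mathcal A$ be self-adjoint, and let $f,g$ be real-valued continuous functions on the spectrum $\sigma(\rho)$ which are same monotonic, that is, $(f(x)-f(y))(g(x)-g(y))\ge 0$ for all $x,y\in\sigma(\rho)$. For $A,B\in\mathcal A$ put $$\mathrm{Corr}^{f,g}_{\rho,\Phi}(A,B)=\Phi\big(f(\rho)g(\rho)A^*B\big)-\Phi\big(f(\rho)A^*g(\rho)B\big),\qquad I^{f,g}_{\rho,\Phi}(A)=\mathrm{Corr}^{f,g}_{\rho,\Phi}(A,A).$$ For $X\in\mathcal B$ write $\mathrm{Re}\,X=\tfrac12(X+X^*)$ and $|X|=(X^*X)^{1/2}$, and let $\le$ be the usual order on the self-adjoint elements of $\mathcal B$. Then, for all self-adjoint $A,B\in\mathcal A$, $$\big|\mathrm{Re}\,\mathrm{Corr}^{f,g}_{\rho,\Phi}(A,B)\big|^2\le I^{f,g}_{\rho,\Phi}(A)\,\big\|I^{f,g}_{\rho,\Phi}(B)\big\|.$$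 If moreover the range $\Phi(\mathcal A)$ is commutative (its elements commute pairwise), then $$\big|\mathrm{Re}\,\mathrm{Corr}^{f,g}_{\rho,\Phi}(A,B)\big|^2\le I^{f,g}_{\rho,\Phi}(A)\,I^{f,g}_{\rho,\Phi}(B).$$ -/

import Mathlib

open scoped ComplexStarModule

namespace VonNeumannAlgebra

variable {H : Type*} [NormedAddCommGroup H] [InnerProductSpace ℂ H] [CompleteSpace H]

instance instSMulMemClass : SMulMemClass (VonNeumannAlgebra H) ℂ (H →L[ℂ] H) where
  smul_mem {s} r _ hx := s.toStarSubalgebra.smul_mem hx r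

/-- A von Neumann algebra is norm closed, hence (by Mathlib's instance for closed star
subalgebras) it is a unital C⋆-algebra for the operations and the norm of `H →L[ℂ] H`. -/
instance instIsClosed (M : VonNeumannAlgebra H) : IsClosed (M : Set (H →L[ℂ] H)) := by
  rw [← M.centralizer_centralizer]
  exact Set.isClosed_centralizer _

/-- The order on `M`, which is the restriction of the Löwner order of `H →L[ℂ] H`, is the
order of the C⋆-algebra `M`: the positive elements are those of the form `star s * s`. -/
instance instStarOrderedRing (M : VonNeumannAlgebra H) : StarOrderedRing M := by
  refine StarOrderedRing.of_le_iff fun x y => ?_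
  constructor
  · intro h
    have h0 : (0 : H →L[ℂ] H) ≤ ((y - x : M) : H →L[ℂ] H) := by
      have h' : (x : H →L[ℂ] H) ≤ y := h
      simpa using h'
    have hsa : IsSelfAdjoint (y - x : M) := Subtype.ext (IsSelfAdjoint.of_nonneg h0)
    have hcl : IsClosed (M.toStarSubalgebra : Set (H →L[ℂ] H)) := M.instIsClosed
    have hsp : SpectrumRestricts (y - x : M) ContinuousMap.realToNNReal := by
      rw [SpectrumRestricts.nnreal_iff]
      intro c hc
      refine spectrum_nonneg_of_nonneg h0 fun hu => hc ?_
      exact (StarSubalgebra.coe_isUnit M.toStarSubalgebra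
        (a := (algebraMap ℝ M c - (y - x) : M))).mp hu
    obtain ⟨s, hs, -, hss⟩ :=
      CFC.exists_sqrt_of_isSelfAdjoint_of_quasispectrumRestricts hsa hsp
    refine ⟨s, ?_⟩
    rw [hs.star_eq, hss]
    abel
  · rintro ⟨s, rfl⟩
    have : (0 : H →L[ℂ] H) ≤ star (s : H →L[ℂ] H) * s := star_mul_self_nonneg _
    change (x : H →L[ℂ] H) ≤ ((x + star s * s : M) : H →L[ℂ] H)
    simp [this]

end VonNeumannAlgebra

/-- A pair of real-valued functions which are continuous on `D` and satisfy
`(f x - f y) * (g x - g y) ≥ 0` for all `x, y ∈ D`. -/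
def SameMonotonicOn (f g : ℝ → ℝ) (D : Set ℝ) : Prop :=
  ContinuousOn f D ∧ ContinuousOn g D ∧
    ∀ x ∈ D, ∀ y ∈ D, 0 ≤ (f x - f y) * (g x - g y)

section Correlation

variable {𝒜 ℬ : Type*} [CStarAlgebra 𝒜] [PartialOrder 𝒜] [CStarAlgebra ℬ] [PartialOrder ℬ]

/-- A positive linear map is tracial if `Φ (X * Y) = Φ (Y * X)`. -/
def IsTracialMap (Φ : 𝒜 →ₚ[ℂ] ℬ) : Prop :=
  ∀ X Y : 𝒜, Φ (X * Y) = Φ (Y * X)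

/-- The generalized correlation `Φ(f(ρ) g(ρ) A* B) - Φ(f(ρ) A* g(ρ) B)`, where `f(ρ)` and `g(ρ)`
are given by the continuous functional calculus. -/
noncomputable def genCorr (Φ : 𝒜 →ₚ[ℂ] ℬ) (ρ : 𝒜) (f g : ℝ → ℝ) (A B : 𝒜) : ℬ :=
  Φ (cfc f ρ * cfc g ρ * star A * B) - Φ (cfc f ρ * star A * cfc g ρ * B)

/-- The generalized Wigner–Yanase–Dyson skew information. -/
noncomputable def skewInfo (Φ : 𝒜 →ₚ[ℂ] ℬ) (ρ : 𝒜) (f g : ℝ → ℝ) (A : 𝒜) : ℬ :=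
  genCorr Φ ρ f g A A

end Correlation

/-!
Why the inequalities hold. Write `F = f(ρ)` and `G = g(ρ)`. Since `Φ` is tracial,
`Re Corr(A, B) = ½ Φ([F, A]* [G, B])` and `I(A) = ½ Φ([F, A]* [G, A])` for self-adjoint `A` and `B`
(`realPart_genCorr`, `skewInfo_eq`). Both claims follow from the positivity of the two-by-two matrix
with entries `I(A)`, `Re Corr(A, B)`, `I(B)`, that is, from
`|⟪ξ, Re Corr(A, B) η⟫|² ≤ ⟪ξ, I(A) ξ⟫ ⟪η, I(B) η⟫` for all vectors `ξ`, `η`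
(`commutatorForm_inner_sq_le`). Taking `η = Re Corr(A, B) ξ` gives the first inequality
(`mul_star_self_le_norm_smul`). If the range of `Φ` is commutative, the second one is a discriminant
inequality, proved character by character (`commuting_star_mul_self_le_mul`).

The matrix positivity is a form of the fact that tracial positive maps are completely positive. Fix
`ξ` and `η` and let `τ x = ⟪ξ, Φ x ξ⟫ + ⟪η, Φ x η⟫`, a tracial positive functional. On its GNS space
`A` acts from the left and, because `τ` is tracial, also from the right by bounded operators. The
functionals `⟪ξ, Φ x ξ⟫`, `⟪ξ, Φ x η⟫`, `⟪η, Φ x η⟫` are given by densities `a`, `c`, `b`, which are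
bounded operators on the GNS space (`exists_densities`); being central, they commute with the left
and right actions and with each other (`IsDensity.commute`). The matrix with rows `(a, c)` and
`(c*, b)` is positive on scalar vectors, hence by commutativity `c* c ≤ a b`.

Finally, the commutator forms are the forms of `a T`, `c T`, `b T`, with
`T = (L_F - R_F) (L_G - R_G)` built from the left and right actions
(`exists_commutatorForm_operator`). At a character, `T` takes a value
`(f s - f t) (g s - g t) ≥ 0` with `s`, `t` in the spectrum of `ρ`; so `T ≥ 0`
(`SameMonotonicOn.cfc_sub_mul_cfc_sub_nonneg`). Since everything commutes, the Cauchy–Schwarz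
inequality for commuting operators (`inner_apply_sq_le_of_star_mul_self_le_mul`) finishes the proof.
-/

/-! ### Commutative C⋆-algebras and characters -/

section CommutativeAlgebra

open scoped InnerProductSpace ComplexOrder

variable {A : Type*} [CommCStarAlgebra A]
open WeakDual

/-- A character turns the continuous functional calculus into evaluation at a point. -/
lemma exists_character_cfc_eq (χ : characterSpace ℂ A) {l : A} (hl : IsSelfAdjoint l) :
    ∃ t ∈ spectrum ℝ l, ∀ f : ℝ → ℝ, ContinuousOn f (spectrum ℝ l) → χ (cfc f l) = f t := by
  have h1 : IsSelfAdjoint (χ l) := hl.map χ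
  obtain ⟨t, ht⟩ := Complex.conj_eq_iff_real.1 h1.star_eq
  have hmem := CharacterSpace.apply_mem_spectrum χ l
  rw [ht] at hmem
  refine ⟨t, (spectrum.algebraMap_mem_iff ℂ).1 hmem, fun f hf => ?_⟩
  have hc : Continuous χ := map_continuous χ
  rw [StarAlgHomClass.map_cfc (S := ℂ) χ f l hf hc hl h1, ht]
  exact cfc_algebraMap t f

variable [PartialOrder A] [StarOrderedRing A]

lemma nonneg_of_forall_character_nonneg {a : A} (h : ∀ χ : characterSpace ℂ A, 0 ≤ χ a) :
    0 ≤ a := by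
  have hsa : IsSelfAdjoint a := by
    refine (gelfandStarTransform A).injective (ContinuousMap.ext fun χ => ?_)
    change χ (star a) = χ a
    rw [map_star]
    exact (IsSelfAdjoint.of_nonneg (h χ)).star_eq
  rw [StarOrderedRing.nonneg_iff_spectrum_nonneg (R := ℝ) a hsa]
  intro x hx
  obtain ⟨χ, hχ⟩ := CharacterSpace.mem_spectrum_iff_exists.1
    ((spectrum.algebraMap_mem_iff ℂ).2 hx)
  have := h χ
  rw [hχ] at this
  exact Complex.zero_le_real.1 this

lemma character_nonneg {a : A} (h : 0 ≤ a) (χ : characterSpace ℂ A) : 0 ≤ χ a := by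
  rw [← CFC.sqrt_mul_sqrt_self a h, map_mul]
  have : IsSelfAdjoint (χ (CFC.sqrt a)) := (IsSelfAdjoint.of_nonneg (CFC.sqrt_nonneg a)).map χ
  nth_rewrite 1 [← this.star_eq]
  exact star_mul_self_nonneg _

/-- At a character the factors become `f s - f t` and `g s - g t` with `s` and `t` in `D`. -/
lemma SameMonotonicOn.cfc_sub_mul_cfc_sub_nonneg {f g : ℝ → ℝ} {D : Set ℝ}
    (hfg : SameMonotonicOn f g D) {l r : A} (hl : IsSelfAdjoint l) (hr : IsSelfAdjoint r)
    (hlD : spectrum ℝ l ⊆ D) (hrD : spectrum ℝ r ⊆ D) :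
    0 ≤ (cfc f l - cfc f r) * (cfc g l - cfc g r) := by
  refine nonneg_of_forall_character_nonneg fun χ => ?_
  obtain ⟨s, hs, hsχ⟩ := exists_character_cfc_eq χ hl
  obtain ⟨t, ht, htχ⟩ := exists_character_cfc_eq χ hr
  rw [map_mul, map_sub, map_sub, hsχ f (hfg.1.mono hlD), htχ f (hfg.1.mono hrD),
    hsχ g (hfg.2.1.mono hlD), htχ g (hfg.2.1.mono hrD)]
  exact_mod_cast hfg.2.2 s (hlD hs) t (hrD ht)

/-- It suffices to use the `z` of the form `t * star c` with `t` real, for which the expression is a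
real quadratic polynomial in `t`. -/
lemma Complex.normSq_le_mul_of_forall_quadratic_nonneg {a b c : ℂ} (ha : 0 ≤ a) (hb : 0 ≤ b)
    (h : ∀ z : ℂ, 0 ≤ a + z * c + star z * star c + (star z * z) * b) :
    star c * c ≤ a * b := by
  obtain ⟨α, rfl⟩ : ∃ α : ℝ, a = α := ⟨a.re, Complex.eq_re_of_ofReal_le ha⟩
  have hα : 0 ≤ α := Complex.zero_le_real.1 ha
  obtain ⟨β, rfl⟩ : ∃ β : ℝ, b = β := ⟨b.re, Complex.eq_re_of_ofReal_le hb⟩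
  have hβ : 0 ≤ β := Complex.zero_le_real.1 hb
  have key : ∀ t : ℝ, 0 ≤ α + 2 * t * Complex.normSq c + t ^ 2 * Complex.normSq c * β := by
    intro t
    have := (Complex.le_def.1 (h (t * star c))).1
    simp [Complex.normSq_apply] at this ⊢
    nlinarith
  have hn := Complex.normSq_nonneg c
  have hd : Complex.normSq c ≤ α * β := by
    have := discrim_le_zero (a := Complex.normSq c * β) (b := 2 * Complex.normSq c) (c := α)
      (fun t => by have := key t; linarith)
    rw [discrim] at this
    by_contra! hlt
    nlinarith [mul_nonneg hα hβ]
  have e : star c * c = (Complex.normSq c : ℂ) := Complex.normSq_eq_conj_mul_self.symm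
  rw [e]
  exact_mod_cast hd

/-- Characters reduce the operator-valued discriminant inequality to the scalar one. -/
lemma star_mul_self_le_mul_of_forall_quadratic_nonneg {a b c : A} (ha : 0 ≤ a) (hb : 0 ≤ b)
    (h : ∀ z : ℂ, 0 ≤ a + z • c + star z • star c + (star z * z) • b) :
    star c * c ≤ a * b := by
  rw [← sub_nonneg]
  refine nonneg_of_forall_character_nonneg fun χ => ?_
  rw [map_sub, map_mul, map_mul, map_star, sub_nonneg]
  refine Complex.normSq_le_mul_of_forall_quadratic_nonneg (character_nonneg ha χ)
    (character_nonneg hb χ) fun z => ?_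
  have := character_nonneg (h z) χ
  rwa [map_add, map_add, map_add, map_smul, map_smul, map_smul, map_star] at this

end CommutativeAlgebra

/-! ### Cauchy–Schwarz inequalities for commuting operators -/

section Operators

open scoped InnerProductSpace ComplexOrder

variable {E : Type*} [NormedAddCommGroup E] [InnerProductSpace ℂ E] [CompleteSpace E]
open ContinuousLinearMap

/-- The double commutant of a commuting, star-closed set is commutative. -/
lemma VonNeumannAlgebra.exists_commutative_of_commuting {S : Set (E →L[ℂ] E)}
    (hstar : ∀ x ∈ S, star x ∈ S) (hcomm : ∀ x ∈ S, ∀ y ∈ S, x * y = y * x) :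
    ∃ M : VonNeumannAlgebra E, S ⊆ M ∧ ∀ x ∈ M, ∀ y ∈ M, x * y = y * x := by
  let N : StarSubalgebra ℂ (E →L[ℂ] E) := StarSubalgebra.centralizer ℂ S
  have hN : (N : Set (E →L[ℂ] E)) = S.centralizer := by
    have : S ∪ star S = S := Set.union_eq_left.2 fun x hx => by simpa using hstar _ hx
    rw [StarSubalgebra.coe_centralizer, this]
  let M' : VonNeumannAlgebra E := ⟨N, by
    change Set.centralizer (Set.centralizer (N : Set (E →L[ℂ] E))) = N
    rw [hN, Set.centralizer_centralizer_centralizer]⟩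
  have hM : (M'.commutant : Set (E →L[ℂ] E)) = S.centralizer.centralizer := by
    rw [VonNeumannAlgebra.coe_commutant, show (M' : Set (E →L[ℂ] E)) = S.centralizer from hN]
  have hS : S ⊆ S.centralizer := fun x hx y hy => hcomm y hy x hx
  refine ⟨M'.commutant, hM ▸ Set.subset_centralizer_centralizer, fun x hx y hy => ?_⟩
  have hx' : x ∈ S.centralizer.centralizer := hM ▸ hx
  have hy' : y ∈ S.centralizer.centralizer := hM ▸ hy
  exact hy' x (Set.centralizer_subset hS hx')

lemma inner_star_mul_self_apply (s : E →L[ℂ] E) (u v : E) :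
    ⟪u, (star s * s) v⟫_ℂ = ⟪s u, s v⟫_ℂ := by
  rw [star_eq_adjoint, mul_def, comp_apply, adjoint_inner_right]

lemma inner_apply_sq_le_of_nonneg {P : E →L[ℂ] E} (hP : 0 ≤ P) (x y : E) :
    ‖⟪x, P y⟫_ℂ‖ ^ 2 ≤ (⟪x, P x⟫_ℂ).re * (⟪y, P y⟫_ℂ).re := by
  obtain ⟨s, rfl⟩ := CStarAlgebra.nonneg_iff_eq_star_mul_self.1 hP
  have e (u : E) : (⟪s u, s u⟫_ℂ).re = ‖s u‖ ^ 2 := (norm_sq_eq_re_inner (𝕜 := ℂ) _).symm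
  rw [inner_star_mul_self_apply, inner_star_mul_self_apply, inner_star_mul_self_apply, e, e,
    ← mul_pow]
  exact pow_le_pow_left₀ (norm_nonneg _) (norm_inner_le_norm _ _) 2

omit [CompleteSpace E] in
lemma re_inner_apply_nonneg {P : E →L[ℂ] E} (hP : 0 ≤ P) (x : E) : 0 ≤ (⟪x, P x⟫_ℂ).re :=
  ((nonneg_iff_isPositive P).1 hP).re_inner_nonneg_right x

lemma re_inner_apply_mono {P Q : E →L[ℂ] E} (hPQ : P ≤ Q) (x : E) :
    (⟪x, P x⟫_ℂ).re ≤ (⟪x, Q x⟫_ℂ).re := by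
  have := re_inner_apply_nonneg (sub_nonneg.2 hPQ) x
  simpa [inner_sub_right] using this

/-- The perturbation `P + ε` has an inverse `i`, and `C = (P + ε) * (i * C)` reduces the claim to
the Cauchy–Schwarz inequality for the form of `P + ε`. -/
lemma inner_apply_sq_le_of_star_mul_self_le_mul {P Q C : E →L[ℂ] E} (hP : 0 ≤ P) (hQ : 0 ≤ Q)
    (hPQ : Commute P Q) (hPC : Commute P C) (hC : star C * C ≤ P * Q) (x y : E) :
    ‖⟪x, C y⟫_ℂ‖ ^ 2 ≤ (⟪x, P x⟫_ℂ).re * (⟪y, Q y⟫_ℂ).re := by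
  have key : ∀ ε : ℝ, 0 < ε →
      ‖⟪x, C y⟫_ℂ‖ ^ 2 ≤ ((⟪x, P x⟫_ℂ).re + ε * ‖x‖ ^ 2) * (⟪y, Q y⟫_ℂ).re := by
    intro ε hε
    set R : E →L[ℂ] E := P + algebraMap ℝ _ ε with hR
    have hεR : algebraMap ℝ (E →L[ℂ] E) ε ≤ R := le_add_of_nonneg_left hP
    have hε0 : (0 : E →L[ℂ] E) ≤ algebraMap ℝ _ ε := by
      simpa using (algebraMap_nonneg (E →L[ℂ] E) hε.le)
    have hR0 : 0 ≤ R := hε0.trans hεR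
    have hu : IsUnit R := CStarAlgebra.isUnit_of_le _ hεR
      ⟨hε0, (IsUnit.mk0 ε hε.ne').map (algebraMap ℝ (E →L[ℂ] E))⟩
    obtain ⟨u, hu⟩ := hu
    have hRC : Commute R C := hPC.add_left (Algebra.commutes ε C)
    have hRQ : Commute R Q := hPQ.add_left (Algebra.commutes ε Q)
    have hRsC : Commute R (star C) := by
      have := hRC.star_star
      rwa [(IsSelfAdjoint.of_nonneg hR0).star_eq] at this
    set i : E →L[ℂ] E := ↑u⁻¹ with hi
    have hRi : R * i = 1 := by rw [← hu, hi, Units.mul_inv]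
    have hi0 : 0 ≤ i := by
      have hsi : star i = i := by
        have h1 : star i * R = 1 := by
          have := congrArg star hRi
          rwa [star_mul, (IsSelfAdjoint.of_nonneg hR0).star_eq, star_one] at this
        calc star i = star i * (R * i) := by rw [hRi, mul_one]
          _ = i := by rw [← mul_assoc, h1, one_mul]
      have : i = star i * R * i := by rw [mul_assoc, hRi, mul_one, hsi]
      rw [this]
      exact star_left_conjugate_nonneg hR0 i
    have hiC : Commute i C := by rw [hi]; rw [← hu] at hRC; exact hRC.units_inv_left
    have hiQ : Commute i Q := by rw [hi]; rw [← hu] at hRQ; exact hRQ.units_inv_left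
    have hisC : Commute i (star C) := by rw [hi]; rw [← hu] at hRsC; exact hRsC.units_inv_left
    have hiR : Commute i R := by rw [hi, ← hu]; exact (Units.commute_inv_coe u)
    have hsi : star i = i := (IsSelfAdjoint.of_nonneg hi0).star_eq
    have hle : star (i * C) * R * (i * C) ≤ Q := by
      have h1 : 0 ≤ i * (R * Q - star C * C) := by
        refine Commute.mul_nonneg hi0 ?_ ?_
        · rw [hR, add_mul, add_sub_right_comm]
          refine add_nonneg (sub_nonneg.2 hC) ?_
          exact Commute.mul_nonneg hε0 hQ (Algebra.commutes ε Q)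
        · exact (hiR.mul_right hiQ).sub_right (hisC.mul_right hiC)
      have h2 : i * (R * Q - star C * C) = Q - star (i * C) * R * (i * C) := by
        have h3 : star (i * C) * R * (i * C) = i * (star C * C) := by
          rw [star_mul, hsi]
          calc star C * i * R * (i * C) = star C * i * (R * i) * C := by simp only [mul_assoc]
            _ = i * (star C * C) := by rw [hRi, mul_one, ← hisC.eq, mul_assoc]
        rw [h3, mul_sub, ← mul_assoc i R Q, hiR.eq, hRi, one_mul]
      rw [h2] at h1
      exact sub_nonneg.1 h1
    have hCeq : C = R * (i * C) := by rw [← mul_assoc, hRi, one_mul]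
    have hRx : (⟪x, R x⟫_ℂ).re = (⟪x, P x⟫_ℂ).re + ε * ‖x‖ ^ 2 := by
      rw [hR, add_apply, inner_add_right, Complex.add_re, Algebra.algebraMap_eq_smul_one,
        smul_apply, one_apply_eq_self, inner_smul_right_eq_smul, inner_self_eq_norm_sq_to_K]
      simp [← Complex.ofReal_pow]
    calc ‖⟪x, C y⟫_ℂ‖ ^ 2 = ‖⟪x, R ((i * C) y)⟫_ℂ‖ ^ 2 := by
          conv_lhs => rw [hCeq]
          rfl
      _ ≤ (⟪x, R x⟫_ℂ).re * (⟪(i * C) y, R ((i * C) y)⟫_ℂ).re :=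
          inner_apply_sq_le_of_nonneg hR0 _ _
      _ = (⟪x, R x⟫_ℂ).re * (⟪y, (star (i * C) * R * (i * C)) y⟫_ℂ).re := by
          rw [mul_assoc]
          exact congrArg (fun z : ℂ => (⟪x, R x⟫_ℂ).re * z.re)
            (adjoint_inner_right (i * C) y (R ((i * C) y))).symm
      _ ≤ (⟪x, R x⟫_ℂ).re * (⟪y, Q y⟫_ℂ).re :=
          mul_le_mul_of_nonneg_left (re_inner_apply_mono hle y) (re_inner_apply_nonneg hR0 x)
      _ = _ := by rw [hRx]
  have hlim : Filter.Tendsto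
      (fun ε : ℝ => ((⟪x, P x⟫_ℂ).re + ε * ‖x‖ ^ 2) * (⟪y, Q y⟫_ℂ).re) (nhdsWithin 0 (Set.Ioi 0))
      (nhds (((⟪x, P x⟫_ℂ).re + 0 * ‖x‖ ^ 2) * (⟪y, Q y⟫_ℂ).re)) :=
    (Continuous.tendsto (by fun_prop) 0).mono_left nhdsWithin_le_nhds
  rw [zero_mul, add_zero] at hlim
  exact ge_of_tendsto hlim (Filter.eventually_of_mem self_mem_nhdsWithin key)

end Operators

/-! ### The GNS space of a tracial functional and its central densities -/

section TracialGNS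

open scoped InnerProductSpace ComplexOrder
open ContinuousLinearMap UniformSpace Completion
namespace PositiveLinearMap

variable {A : Type*} [CStarAlgebra A] [PartialOrder A] [StarOrderedRing A] (τ : A →ₚ[ℂ] ℂ)

/-- The vector of the GNS space of `τ` represented by `x`. -/
noncomputable def gnsVec : A →ₗ[ℂ] τ.GNS :=
  (toComplL : τ.PreGNS →L[ℂ] τ.GNS).toLinearMap ∘ₗ τ.toPreGNS.toLinearMap

lemma gnsVec_apply (x : A) : τ.gnsVec x = ((τ.toPreGNS x : τ.PreGNS) : τ.GNS) := rfl

lemma inner_gnsVec (x y : A) : ⟪τ.gnsVec x, τ.gnsVec y⟫_ℂ = τ (star x * y) := by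
  rw [gnsVec_apply, gnsVec_apply, inner_coe]
  rfl

lemma denseRange_gnsVec : DenseRange τ.gnsVec :=
  (denseRange_coe (α := τ.PreGNS)).comp τ.toPreGNS.surjective.denseRange
    (continuous_coe (α := τ.PreGNS))

variable {τ}

lemma gns_eq_of_eq_gnsVec {X : Type*} [TopologicalSpace X] [T2Space X] {F G : τ.GNS → X}
    (hF : Continuous F) (hG : Continuous G) (h : ∀ x, F (τ.gnsVec x) = G (τ.gnsVec x))
    (u : τ.GNS) : F u = G u :=
  congrFun (τ.denseRange_gnsVec.equalizer hF hG (funext h)) u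

lemma gns_ext {u v : τ.GNS} (h : ∀ x, ⟪τ.gnsVec x, u⟫_ℂ = ⟪τ.gnsVec x, v⟫_ℂ) : u = v :=
  ext_inner_left ℂ (gns_eq_of_eq_gnsVec (by fun_prop) (by fun_prop) h)

lemma gns_clm_ext_vec {h k : τ.GNS →L[ℂ] τ.GNS} (H : ∀ y, h (τ.gnsVec y) = k (τ.gnsVec y)) :
    h = k :=
  ContinuousLinearMap.ext fun w => gns_eq_of_eq_gnsVec h.continuous k.continuous H w

lemma gns_clm_ext {h k : τ.GNS →L[ℂ] τ.GNS}
    (H : ∀ x y, ⟪τ.gnsVec x, h (τ.gnsVec y)⟫_ℂ = ⟪τ.gnsVec x, k (τ.gnsVec y)⟫_ℂ) : h = k :=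
  gns_clm_ext_vec fun y => gns_ext fun x => H x y

lemma gnsStarAlgHom_gnsVec (a x : A) : τ.gnsStarAlgHom a (τ.gnsVec x) = τ.gnsVec (a * x) := by
  change τ.gnsNonUnitalStarAlgHom a _ = _
  rw [gnsVec_apply, gnsNonUnitalStarAlgHom_apply_coe]
  rfl

lemma norm_toPreGNS_star (hτ : IsTracialMap τ) (x : A) :
    ‖τ.toPreGNS (star x)‖ = ‖τ.toPreGNS x‖ := by
  rw [preGNS_norm_def, preGNS_norm_def, ofPreGNS_toPreGNS, ofPreGNS_toPreGNS, star_star, hτ]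

/-- The extension of `x ↦ star x` to the GNS space of a tracial functional. For functionals which
are not tracial it is junk. -/
noncomputable def gnsConj (τ : A →ₚ[ℂ] ℂ) : τ.GNS → τ.GNS :=
  Completion.map fun x : τ.PreGNS => τ.toPreGNS (star (τ.ofPreGNS x))

lemma continuous_gnsConj : Continuous τ.gnsConj := Completion.continuous_map

lemma gnsConj_gnsVec (hτ : IsTracialMap τ) (x : A) :
    τ.gnsConj (τ.gnsVec x) = τ.gnsVec (star x) := by
  have : Isometry fun x : τ.PreGNS => τ.toPreGNS (star (τ.ofPreGNS x)) := by
    refine Isometry.of_dist_eq fun x y => ?_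
    rw [dist_eq_norm, dist_eq_norm, ← map_sub, ← star_sub, ← map_sub, norm_toPreGNS_star hτ,
      toPreGNS_ofPreGNS]
  exact Completion.map_coe this.uniformContinuous _

lemma inner_gnsVec_gnsConj (hτ : IsTracialMap τ) (x : A) (u : τ.GNS) :
    ⟪τ.gnsVec x, τ.gnsConj u⟫_ℂ = ⟪u, τ.gnsVec (star x)⟫_ℂ := by
  refine gns_eq_of_eq_gnsVec (F := fun u => ⟪τ.gnsVec x, τ.gnsConj u⟫_ℂ)
    (G := fun u => ⟪u, τ.gnsVec (star x)⟫_ℂ) (continuous_const.inner continuous_gnsConj)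
    (by fun_prop) (fun y => ?_) u
  rw [gnsConj_gnsVec hτ, inner_gnsVec, inner_gnsVec, hτ]

/-- Right multiplication by `star a` on the pre-Hilbert space of a tracial functional. -/
noncomputable def rightMulStarPreGNS (hτ : IsTracialMap τ) (a : A) : τ.PreGNS →L[ℂ] τ.PreGNS :=
  (τ.toPreGNS.toLinearMap ∘ₗ (LinearMap.mulRight ℂ (star a)) ∘ₗ
    τ.ofPreGNS.toLinearMap).mkContinuous ‖τ.leftMulMapPreGNS a‖ fun x => by
      have h1 := (τ.leftMulMapPreGNS a).le_opNorm (τ.toPreGNS (star (τ.ofPreGNS x)))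
      rw [norm_toPreGNS_star hτ] at h1
      refine le_of_eq_of_le ?_ h1
      rw [leftMulMapPreGNS_apply, ← norm_toPreGNS_star hτ, ofPreGNS_toPreGNS]
      simp

/-- The right regular representation on the GNS space of a tracial functional: `a` acts as right
multiplication by `star a`. The star turns an antihomomorphism into a homomorphism, at the price
of complex linearity. -/
noncomputable def gnsRight (hτ : IsTracialMap τ) : A →⋆ₐ[ℝ] (τ.GNS →L[ℂ] τ.GNS) :=
  have key (a x : A) : (rightMulStarPreGNS hτ a).completion (τ.gnsVec x) =
      τ.gnsVec (x * star a) := by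
    rw [gnsVec_apply, completion_apply_coe]; rfl
  { toFun := fun a => (rightMulStarPreGNS hτ a).completion
    map_one' := gns_clm_ext_vec fun x => by rw [key]; simp
    map_zero' := gns_clm_ext_vec fun x => by rw [key]; simp
    map_add' := fun a b => gns_clm_ext_vec fun x => by
      rw [_root_.add_apply, key, key, key, ← map_add, star_add, mul_add]
    map_mul' := fun a b => gns_clm_ext_vec fun x => by
      rw [ContinuousLinearMap.mul_def, ContinuousLinearMap.comp_apply, key, key, key, star_mul,
        mul_assoc]
    commutes' := fun r => gns_clm_ext_vec fun x => by
      rw [key, Algebra.algebraMap_eq_smul_one, Algebra.algebraMap_eq_smul_one, _root_.smul_apply,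
        star_smul, star_one, mul_smul_comm, mul_one, one_apply_eq_self, star_trivial,
        ← Complex.coe_smul, ← Complex.coe_smul, map_smul]
    map_star' := fun a => gns_clm_ext fun x y => by
      rw [star_eq_adjoint, adjoint_inner_right, key, key, inner_gnsVec, inner_gnsVec, star_star,
        star_mul, star_star, ← mul_assoc, hτ, mul_assoc] }

lemma gnsRight_gnsVec (hτ : IsTracialMap τ) (a x : A) :
    gnsRight hτ a (τ.gnsVec x) = τ.gnsVec (x * star a) := by
  change (rightMulStarPreGNS hτ a).completion (τ.gnsVec x) = _
  rw [gnsVec_apply, completion_apply_coe]; rfl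

lemma norm_gnsConj (hτ : IsTracialMap τ) (u : τ.GNS) : ‖τ.gnsConj u‖ = ‖u‖ := by
  refine gns_eq_of_eq_gnsVec (F := fun u => ‖τ.gnsConj u‖) (G := fun u => ‖u‖)
    continuous_gnsConj.norm continuous_norm (fun x => ?_) u
  rw [gnsConj_gnsVec hτ, gnsVec_apply, gnsVec_apply, norm_coe, norm_coe, norm_toPreGNS_star hτ]

lemma gnsRight_eq_gnsConj (hτ : IsTracialMap τ) (a : A) (u : τ.GNS) :
    gnsRight hτ a u = τ.gnsConj (τ.gnsStarAlgHom a (τ.gnsConj u)) := by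
  refine gns_eq_of_eq_gnsVec (F := fun u => gnsRight hτ a u)
    (G := fun u => τ.gnsConj (τ.gnsStarAlgHom a (τ.gnsConj u))) (gnsRight hτ a).continuous
    (continuous_gnsConj.comp ((τ.gnsStarAlgHom a).continuous.comp continuous_gnsConj))
    (fun x => ?_) u
  rw [gnsRight_gnsVec, gnsConj_gnsVec hτ, gnsStarAlgHom_gnsVec, gnsConj_gnsVec hτ, star_mul,
    star_star]

lemma continuous_gnsRight (hτ : IsTracialMap τ) : Continuous (gnsRight hτ) := by
  refine AddMonoidHomClass.continuous_of_bound (gnsRight hτ) 1 fun a => ?_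
  rw [one_mul]
  refine opNorm_le_bound _ (norm_nonneg a) fun u => ?_
  rw [gnsRight_eq_gnsConj, norm_gnsConj hτ]
  refine ((τ.gnsStarAlgHom a).le_opNorm _).trans ?_
  rw [norm_gnsConj hτ]
  gcongr
  exact NonUnitalStarAlgHom.norm_apply_le τ.gnsStarAlgHom a

/-- The operator `h` on the GNS space of `τ` is the density of `ψ` with respect to `τ`:
`⟪x, h y⟫ = ψ (x* y)` on the dense image of `A`. Linearity of `ψ` is not required, since it follows
from the existence of `h`. -/
def IsDensity (τ : A →ₚ[ℂ] ℂ) (ψ : A → ℂ) (h : τ.GNS →L[ℂ] τ.GNS) : Prop :=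
  ∀ x y, ⟪τ.gnsVec x, h (τ.gnsVec y)⟫_ℂ = ψ (star x * y)

/-- A positive functional dominated by `τ` has a positive density: the identity of `A` extends to
a bounded operator `V` between the two GNS spaces, and `V† V` is the density. -/
lemma exists_isDensity_of_le (ψ : A →ₚ[ℂ] ℂ) {C : ℝ} (hC : 0 ≤ C)
    (h : ∀ x, (ψ (star x * x)).re ≤ C * (τ (star x * x)).re) :
    ∃ k : τ.GNS →L[ℂ] τ.GNS, 0 ≤ k ∧ IsDensity τ ψ k := by
  let V₀ : τ.PreGNS →L[ℂ] ψ.PreGNS :=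
    (ψ.toPreGNS.toLinearMap ∘ₗ τ.ofPreGNS.toLinearMap).mkContinuous √C fun x => by
      rw [preGNS_norm_def, preGNS_norm_def, ← Real.sqrt_mul hC]
      exact Real.sqrt_le_sqrt (h _)
  let V : τ.GNS →L[ℂ] ψ.GNS := V₀.completion
  have hV (x : A) : V (τ.gnsVec x) = ψ.gnsVec x := completion_apply_coe _ _
  refine ⟨adjoint V ∘L V, (nonneg_iff_isPositive _).2 (isPositive_adjoint_comp_self V),
    fun x y => ?_⟩
  rw [ContinuousLinearMap.comp_apply, adjoint_inner_right, hV, hV, inner_gnsVec]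

namespace IsDensity

variable {φ ψ : A → ℂ} {h k : τ.GNS →L[ℂ] τ.GNS}

lemma unique (hh : IsDensity τ φ h) (hk : IsDensity τ φ k) : h = k :=
  gns_clm_ext fun x y => (hh x y).trans (hk x y).symm

lemma add (hh : IsDensity τ φ h) (hk : IsDensity τ ψ k) :
    IsDensity τ (fun x => φ x + ψ x) (h + k) := fun x y => by
  rw [_root_.add_apply, inner_add_right, hh, hk]

lemma smul (hh : IsDensity τ φ h) (c : ℂ) : IsDensity τ (fun x => c * φ x) (c • h) :=
  fun x y => by rw [_root_.smul_apply, inner_smul_right, hh]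

lemma star (hh : IsDensity τ φ h) :
    IsDensity τ (fun x => star (φ (star x))) (star h) := fun x y => by
  rw [star_eq_adjoint, adjoint_inner_right, ← inner_conj_symm, hh]
  change _ = Star.star (φ (Star.star (Star.star x * y)))
  rw [star_mul, star_star]
  rfl

lemma commute_left (hh : IsDensity τ φ h) (a : A) : Commute h (τ.gnsStarAlgHom a) :=
  gns_clm_ext fun x y => by
    rw [ContinuousLinearMap.mul_def, ContinuousLinearMap.comp_apply, ContinuousLinearMap.mul_def,
      ContinuousLinearMap.comp_apply, gnsStarAlgHom_gnsVec, hh,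
      ← adjoint_inner_left, ← star_eq_adjoint, ← map_star, gnsStarAlgHom_gnsVec, hh, star_mul,
      star_star, mul_assoc]

lemma commute_right (hτ : IsTracialMap τ) (hφ : ∀ x y, φ (x * y) = φ (y * x))
    (hh : IsDensity τ φ h) (a : A) : Commute h (gnsRight hτ a) :=
  gns_clm_ext fun x y => by
    rw [ContinuousLinearMap.mul_def, ContinuousLinearMap.comp_apply, ContinuousLinearMap.mul_def,
      ContinuousLinearMap.comp_apply, gnsRight_gnsVec, hh,
      ← adjoint_inner_left, ← star_eq_adjoint, ← map_star, gnsRight_gnsVec, hh, star_mul,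
      star_star, ← mul_assoc, hφ, mul_assoc]

/-- The density of a tracial functional commutes with every density. All densities commute with the
left action, so it suffices to compare the two products at the cyclic vector; there `gnsConj`
exchanges a density with its adjoint, and traciality of `ψ` moves the remaining factor across. -/
lemma commute (hτ : IsTracialMap τ) (hψ : ∀ x y, ψ (x * y) = ψ (y * x))
    (hh : IsDensity τ φ h) (hk : IsDensity τ ψ k) : Commute h k := by
  have hvec (a : A) : τ.gnsVec a = τ.gnsStarAlgHom a (τ.gnsVec 1) := by
    rw [gnsStarAlgHom_gnsVec, mul_one]
  have hone : h (k (τ.gnsVec 1)) = k (h (τ.gnsVec 1)) := by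
    have hconj : τ.gnsConj (Star.star h (τ.gnsVec 1)) = h (τ.gnsVec 1) := gns_ext fun x => by
      rw [inner_gnsVec_gnsConj hτ, star_eq_adjoint, adjoint_inner_left, hh, hh, star_one,
        one_mul, mul_one]
    have hu (x : A) (u : τ.GNS) : ⟪τ.gnsStarAlgHom x u, k (τ.gnsVec 1)⟫_ℂ =
        ⟪Star.star k (τ.gnsVec x), τ.gnsConj u⟫_ℂ := by
      refine gns_eq_of_eq_gnsVec (F := fun u => ⟪τ.gnsStarAlgHom x u, k (τ.gnsVec 1)⟫_ℂ)
        (by fun_prop) (continuous_const.inner continuous_gnsConj) (fun a => ?_) u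
      rw [gnsStarAlgHom_gnsVec, hk, gnsConj_gnsVec hτ, star_eq_adjoint, adjoint_inner_left, hk,
        mul_one, star_mul, hψ]
    refine gns_ext fun x => ?_
    have e : τ.gnsStarAlgHom x (Star.star h (τ.gnsVec 1)) = Star.star h (τ.gnsVec x) := by
      have := congrArg (fun T : τ.GNS →L[ℂ] τ.GNS => T (τ.gnsVec 1))
        (hh.star.commute_left x).eq
      simp only [ContinuousLinearMap.mul_def, ContinuousLinearMap.comp_apply] at this
      rw [← this, ← hvec]
    have := hu x (Star.star h (τ.gnsVec 1))
    rw [e, hconj] at this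
    rwa [star_eq_adjoint, adjoint_inner_left, star_eq_adjoint, adjoint_inner_left] at this
  refine gns_clm_ext_vec fun a => ?_
  have c1 := congrArg (fun T : τ.GNS →L[ℂ] τ.GNS => T (τ.gnsVec 1))
    (((hh.commute_left a).mul_left (hk.commute_left a))).eq
  have c2 := congrArg (fun T : τ.GNS →L[ℂ] τ.GNS => T (τ.gnsVec 1))
    (((hk.commute_left a).mul_left (hh.commute_left a))).eq
  simp only [ContinuousLinearMap.mul_def, ContinuousLinearMap.comp_apply] at c1 c2 ⊢
  rw [hvec, c1, c2, hone]

end IsDensity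

lemma commute_gnsStarAlgHom_gnsRight (hτ : IsTracialMap τ) (a b : A) :
    Commute (τ.gnsStarAlgHom a) (gnsRight hτ b) :=
  gns_clm_ext_vec fun x => by
    rw [ContinuousLinearMap.mul_def, ContinuousLinearMap.comp_apply, ContinuousLinearMap.mul_def,
      ContinuousLinearMap.comp_apply, gnsRight_gnsVec, gnsStarAlgHom_gnsVec,
      gnsStarAlgHom_gnsVec, gnsRight_gnsVec, mul_assoc]

end PositiveLinearMap

end TracialGNS

/-! ### Commutative von Neumann algebras -/

section CommutingOperators

open scoped InnerProductSpace ComplexOrder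

variable {E : Type*} [NormedAddCommGroup E] [InnerProductSpace ℂ E] [CompleteSpace E]

/-- A von Neumann algebra with commuting elements as a commutative C⋆-algebra. -/
noncomputable abbrev VonNeumannAlgebra.commCStarAlgebra (M : VonNeumannAlgebra E)
    (hM : ∀ x ∈ M, ∀ y ∈ M, x * y = y * x) : CommCStarAlgebra M :=
  { (inferInstance : CStarAlgebra M) with
    mul_comm := fun x y => Subtype.ext (hM x x.2 y y.2) }

lemma VonNeumannAlgebra.spectrum_coe (M : VonNeumannAlgebra E) (l : M) :
    spectrum ℝ l = spectrum ℝ (l : E →L[ℂ] E) := by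
  have hcl : IsClosed (M.toStarSubalgebra : Set (E →L[ℂ] E)) := M.instIsClosed
  ext t
  refine not_congr ?_
  exact (StarSubalgebra.coe_isUnit M.toStarSubalgebra (a := (algebraMap ℝ M t - l : M))).symm

lemma VonNeumannAlgebra.coe_cfc (M : VonNeumannAlgebra E) {l : M} (hl : IsSelfAdjoint l)
    {f : ℝ → ℝ} (hf : ContinuousOn f (spectrum ℝ l)) :
    ((cfc f l : M) : E →L[ℂ] E) = cfc f (l : E →L[ℂ] E) := by
  have hcl : IsClosed (M.toStarSubalgebra : Set (E →L[ℂ] E)) := M.instIsClosed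
  exact StarAlgHomClass.map_cfc (S := ℂ) M.toStarSubalgebra.subtype f l hf
    continuous_subtype_val hl (hl.map M.toStarSubalgebra.subtype)

lemma commuting_cfc_sub_mul_cfc_sub_nonneg (M : VonNeumannAlgebra E)
    (hM : ∀ x ∈ M, ∀ y ∈ M, x * y = y * x) {f g : ℝ → ℝ} {D : Set ℝ}
    (hfg : SameMonotonicOn f g D) {l r : E →L[ℂ] E} (hlM : l ∈ M) (hrM : r ∈ M)
    (hl : IsSelfAdjoint l) (hr : IsSelfAdjoint r)
    (hlD : spectrum ℝ l ⊆ D) (hrD : spectrum ℝ r ⊆ D) :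
    0 ≤ (cfc f l - cfc f r) * (cfc g l - cfc g r) ∧
      (cfc f l - cfc f r) * (cfc g l - cfc g r) ∈ M := by
  let _ := M.commCStarAlgebra hM
  lift l to M using hlM
  lift r to M using hrM
  have hl' : IsSelfAdjoint l := Subtype.ext hl
  have hr' : IsSelfAdjoint r := Subtype.ext hr
  rw [← M.spectrum_coe] at hlD hrD
  rw [← M.coe_cfc hl' (hfg.1.mono hlD), ← M.coe_cfc hr' (hfg.1.mono hrD),
    ← M.coe_cfc hl' (hfg.2.1.mono hlD), ← M.coe_cfc hr' (hfg.2.1.mono hrD)]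
  exact ⟨hfg.cfc_sub_mul_cfc_sub_nonneg hl' hr' hlD hrD, SetLike.coe_mem
    ((cfc f l - cfc f r) * (cfc g l - cfc g r) : M)⟩

lemma commuting_star_mul_self_le_mul (M : VonNeumannAlgebra E)
    (hM : ∀ x ∈ M, ∀ y ∈ M, x * y = y * x) {a b c : E →L[ℂ] E} (haM : a ∈ M) (hbM : b ∈ M)
    (hcM : c ∈ M) (ha : 0 ≤ a) (hb : 0 ≤ b)
    (h : ∀ z : ℂ, 0 ≤ a + z • c + star z • star c + (star z * z) • b) :
    star c * c ≤ a * b := by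
  let _ := M.commCStarAlgebra hM
  lift a to M using haM
  lift b to M using hbM
  lift c to M using hcM
  exact star_mul_self_le_mul_of_forall_quadratic_nonneg (A := M) ha hb h

/-- Cauchy–Schwarz inequality for the forms of `a * T`, `b * T` and `c * T`: the
weight `T ≥ 0` can be multiplied into `a`, `b` and `c` because everything commutes. -/
lemma commuting_inner_sq_le (M : VonNeumannAlgebra E)
    (hM : ∀ x ∈ M, ∀ y ∈ M, x * y = y * x) {a b c T : E →L[ℂ] E} (haM : a ∈ M) (hbM : b ∈ M)
    (hcM : c ∈ M) (hTM : T ∈ M) (ha : 0 ≤ a) (hb : 0 ≤ b) (hT : 0 ≤ T)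
    (h : ∀ z : ℂ, 0 ≤ a + z • c + star z • star c + (star z * z) • b) (x y : E) :
    ‖⟪x, (c * T) y⟫_ℂ‖ ^ 2 ≤ (⟪x, (a * T) x⟫_ℂ).re * (⟪y, (b * T) y⟫_ℂ).re := by
  have haT : 0 ≤ a * T := Commute.mul_nonneg ha hT (hM a haM T hTM)
  have hbT : 0 ≤ b * T := Commute.mul_nonneg hb hT (hM b hbM T hTM)
  have haTM := mul_mem haM hTM
  have hbTM := mul_mem hbM hTM
  have hcTM := mul_mem hcM hTM
  refine inner_apply_sq_le_of_star_mul_self_le_mul haT hbT (hM _ haTM _ hbTM)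
    (hM _ haTM _ hcTM) (commuting_star_mul_self_le_mul M hM haTM hbTM hcTM haT hbT fun z => ?_)
    x y
  have hscM : star c ∈ M := star_mem hcM
  have hz : a + z • c + star z • star c + (star z * z) • b ∈ M :=
    add_mem (add_mem (add_mem haM (SMulMemClass.smul_mem z hcM))
      (SMulMemClass.smul_mem _ hscM)) (SMulMemClass.smul_mem _ hbM)
  have := Commute.mul_nonneg (h z) hT (hM _ hz T hTM)
  rwa [add_mul, add_mul, add_mul, smul_mul_assoc, smul_mul_assoc, smul_mul_assoc,
    ← (show star (c * T) = star c * T by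
      rw [star_mul, (IsSelfAdjoint.of_nonneg hT).star_eq, hM T hTM _ hscM])] at this

end CommutingOperators

/-! ### Vector functionals of a positive map -/

section Polarization

open scoped InnerProductSpace ComplexOrder

variable {A : Type*} [CStarAlgebra A] [PartialOrder A] [StarOrderedRing A]
variable {K : Type*} [NormedAddCommGroup K] [InnerProductSpace ℂ K] [CompleteSpace K]

/-- The positive functional `x ↦ ⟪ζ, Φ x ζ⟫` of a positive map into bounded operators. -/
noncomputable def vectorFunctional (Φ : A →ₚ[ℂ] (K →L[ℂ] K)) (ζ : K) : A →ₚ[ℂ] ℂ :=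
  PositiveLinearMap.mk₀
    { toFun := fun x => ⟪ζ, Φ x ζ⟫_ℂ
      map_add' := fun x y => by rw [map_add, add_apply, inner_add_right]
      map_smul' := fun c x => by
        rw [map_smul, smul_apply, inner_smul_right, RingHom.id_apply, smul_eq_mul] }
    fun x hx => ((ContinuousLinearMap.nonneg_iff_isPositive _).1
      (Φ.map_nonneg hx)).inner_nonneg_right ζ

/-- The sum of the vector functionals of `ξ` and `η`; it dominates the vector functional of
every linear combination of `ξ` and `η`, up to a constant. -/
noncomputable def pairFunctional (Φ : A →ₚ[ℂ] (K →L[ℂ] K)) (ξ η : K) : A →ₚ[ℂ] ℂ :=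
  PositiveLinearMap.mk₀
    ((vectorFunctional Φ ξ).toLinearMap + (vectorFunctional Φ η).toLinearMap)
    fun _ hx => add_nonneg ((vectorFunctional Φ ξ).map_nonneg hx)
      ((vectorFunctional Φ η).map_nonneg hx)

omit [CompleteSpace K] in
lemma vectorFunctional_apply (Φ : A →ₚ[ℂ] (K →L[ℂ] K)) (ζ : K) (x : A) :
    vectorFunctional Φ ζ x = ⟪ζ, Φ x ζ⟫_ℂ := rfl

omit [CompleteSpace K] in
lemma pairFunctional_apply (Φ : A →ₚ[ℂ] (K →L[ℂ] K)) (ξ η : K) (x : A) :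
    pairFunctional Φ ξ η x = ⟪ξ, Φ x ξ⟫_ℂ + ⟪η, Φ x η⟫_ℂ := rfl

omit [CompleteSpace K] in
lemma vectorFunctional_add_smul_re_le (Φ : A →ₚ[ℂ] (K →L[ℂ] K)) (ξ η : K) (z : ℂ) {x : A}
    (hx : 0 ≤ x) :
    (vectorFunctional Φ (ξ + z • η) x).re ≤
      (2 * (1 + ‖z‖ ^ 2)) * (pairFunctional Φ ξ η x).re := by
  have hP := Φ.map_nonneg hx
  rw [vectorFunctional_apply, pairFunctional_apply]
  set P := Φ x
  have h1 := re_inner_apply_nonneg hP (ξ - z • η)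
  have h2 := re_inner_apply_nonneg hP ξ
  have h3 := re_inner_apply_nonneg hP η
  have h4 : (⟪z • η, P (z • η)⟫_ℂ).re = ‖z‖ ^ 2 * (⟪η, P η⟫_ℂ).re := by
    rw [map_smul, inner_smul_left, inner_smul_right, ← mul_assoc, ← Complex.normSq_eq_conj_mul_self,
      Complex.re_ofReal_mul, Complex.normSq_eq_norm_sq]
  simp only [map_add, map_sub, inner_add_left, inner_add_right, inner_sub_left, inner_sub_right,
    Complex.add_re, Complex.sub_re, h4] at h1 ⊢
  nlinarith [mul_nonneg (sq_nonneg ‖z‖) h2]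

open PositiveLinearMap in
/-- The densities `a`, `b`, `c` of `⟪ξ, Φ x ξ⟫`, `⟪η, Φ x η⟫`, `⟪ξ, Φ x η⟫`. The last one is
obtained by polarization, and the quadratic expression is the density of the vector functional of
`ξ + z • η`. -/
lemma exists_densities (Φ : A →ₚ[ℂ] (K →L[ℂ] K)) (ξ η : K) :
    ∃ a b c : (pairFunctional Φ ξ η).GNS →L[ℂ] (pairFunctional Φ ξ η).GNS,
      0 ≤ a ∧ 0 ≤ b ∧
      (∀ z : ℂ, 0 ≤ a + z • c + star z • star c + (star z * z) • b) ∧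
      IsDensity (pairFunctional Φ ξ η) (fun x => ⟪ξ, Φ x ξ⟫_ℂ) a ∧
      IsDensity (pairFunctional Φ ξ η) (fun x => ⟪η, Φ x η⟫_ℂ) b ∧
      IsDensity (pairFunctional Φ ξ η) (fun x => ⟪ξ, Φ x η⟫_ℂ) c := by
  have hz (z : ℂ) : ∃ k : (pairFunctional Φ ξ η).GNS →L[ℂ] (pairFunctional Φ ξ η).GNS, 0 ≤ k ∧
      IsDensity (pairFunctional Φ ξ η) (vectorFunctional Φ (ξ + z • η)) k :=
    exists_isDensity_of_le _ (by positivity) fun x =>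
      vectorFunctional_add_smul_re_le Φ ξ η z (star_mul_self_nonneg x)
  obtain ⟨b, hb0, hb⟩ : ∃ k : (pairFunctional Φ ξ η).GNS →L[ℂ] (pairFunctional Φ ξ η).GNS,
      0 ≤ k ∧ IsDensity (pairFunctional Φ ξ η) (vectorFunctional Φ η) k :=
    exists_isDensity_of_le _ zero_le_one fun x => by
      rw [one_mul, pairFunctional_apply, vectorFunctional_apply, Complex.add_re]
      exact le_add_of_nonneg_left
        (re_inner_apply_nonneg (Φ.map_nonneg (star_mul_self_nonneg x)) ξ)
  choose d hd0 hd using hz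
  have hq (z : ℂ) (P : K →L[ℂ] K) : ⟪ξ + z • η, P (ξ + z • η)⟫_ℂ =
      ⟪ξ, P ξ⟫_ℂ + z * ⟪ξ, P η⟫_ℂ + star z * ⟪η, P ξ⟫_ℂ + (star z * z) * ⟪η, P η⟫_ℂ := by
    simp only [map_add, map_smul, inner_add_left, inner_add_right, inner_smul_left,
      inner_smul_right, Complex.star_def]
    ring
  have ha : IsDensity (pairFunctional Φ ξ η) (fun x => ⟪ξ, Φ x ξ⟫_ℂ) (d 0) := fun x y => by
    rw [hd, vectorFunctional_apply, zero_smul, add_zero]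
  -- With `q z = ⟪ξ + z η, P (ξ + z η)⟫`, one has
  -- `2 ⟪ξ, P η⟫ = (q 1 - ⟪ξ, P ξ⟫ - ⟪η, P η⟫) - i (q i - ⟪ξ, P ξ⟫ - ⟪η, P η⟫)`.
  set c := (2⁻¹ : ℂ) • ((d 1 + (-1 : ℂ) • (d 0 + b)) +
    (-Complex.I) • (d Complex.I + (-1 : ℂ) • (d 0 + b))) with hc_def
  have hc : IsDensity (pairFunctional Φ ξ η) (fun x => ⟪ξ, Φ x η⟫_ℂ) c := by
    intro x y
    have := ((((hd 1).add ((ha.add hb).smul (-1))).add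
      (((hd Complex.I).add ((ha.add hb).smul (-1))).smul (-Complex.I))).smul 2⁻¹) x y
    rw [hc_def, this]
    simp only [vectorFunctional_apply, hq, star_one, Complex.star_def, Complex.conj_I]
    linear_combination (2⁻¹ * (⟪η, Φ (star x * y) η⟫_ℂ * Complex.I - ⟪ξ, Φ (star x * y) η⟫_ℂ +
      ⟪η, Φ (star x * y) ξ⟫_ℂ)) * Complex.I_mul_I
  refine ⟨d 0, b, c, hd0 0, hb0, fun z => ?_, ha, hb, hc⟩
  have hstar (x : A) : star ⟪ξ, Φ (star x) η⟫_ℂ = ⟪η, Φ x ξ⟫_ℂ := by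
    rw [map_star, ContinuousLinearMap.star_eq_adjoint, ContinuousLinearMap.adjoint_inner_right]
    exact inner_conj_symm _ _
  have key := ((ha.add (hc.smul z)).add (hc.star.smul (star z))).add (hb.smul (star z * z))
  have heq : d 0 + z • c + star z • star c + (star z * z) • b = d z :=
    IsDensity.unique (fun x y => (key x y).trans (by
      simp only [vectorFunctional_apply, hq, hstar])) (hd z)
  rw [heq]
  exact hd0 z

end Polarization

/-! ### Operator inequalities from form inequalities -/

section OperatorForms

open scoped InnerProductSpace ComplexOrder
open ContinuousLinearMap

variable {K : Type*} [NormedAddCommGroup K] [InnerProductSpace ℂ K] [CompleteSpace K]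
  {p q c : K →L[ℂ] K}

/-- This is the hypothesis at `η = star c ξ`, where `⟪ξ, c η⟫ = ‖η‖ ^ 2`. -/
lemma mul_star_self_le_norm_smul (hp : 0 ≤ p)
    (h : ∀ ξ η, ‖⟪ξ, c η⟫_ℂ‖ ^ 2 ≤ (⟪ξ, p ξ⟫_ℂ).re * (⟪η, q η⟫_ℂ).re) :
    c * star c ≤ ‖q‖ • p := by
  have hsa : IsSelfAdjoint (‖q‖ • p - c * star c) :=
    ((IsSelfAdjoint.all ‖q‖).smul (.of_nonneg hp)).sub (.mul_star_self c)
  rw [← sub_nonneg, nonneg_iff_isPositive, isPositive_def']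
  refine ⟨hsa, fun ξ => ?_⟩
  rw [reApplyInnerSelf_apply, ← inner_re_symm]
  set η := star c ξ with hη
  have h1 : ⟪ξ, c η⟫_ℂ = (‖η‖ : ℂ) ^ 2 := by
    have := inner_self_eq_norm_sq_to_K (𝕜 := ℂ) η
    nth_rewrite 1 [hη] at this
    rwa [star_eq_adjoint, adjoint_inner_left] at this
  have h2 : (⟪η, q η⟫_ℂ).re ≤ ‖q‖ * ‖η‖ ^ 2 := by
    calc (⟪η, q η⟫_ℂ).re ≤ ‖η‖ * ‖q η‖ := re_inner_le_norm (𝕜 := ℂ) _ _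
      _ ≤ ‖η‖ * (‖q‖ * ‖η‖) := by gcongr; exact q.le_opNorm η
      _ = _ := by ring
  have h3 : ‖η‖ ^ 2 * ‖η‖ ^ 2 ≤ (‖q‖ * (⟪ξ, p ξ⟫_ℂ).re) * ‖η‖ ^ 2 := by
    calc ‖η‖ ^ 2 * ‖η‖ ^ 2 = ‖⟪ξ, c η⟫_ℂ‖ ^ 2 := by
          rw [h1, norm_pow, Complex.norm_real, norm_norm]; ring
      _ ≤ _ := h ξ η
      _ ≤ (⟪ξ, p ξ⟫_ℂ).re * (‖q‖ * ‖η‖ ^ 2) :=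
        mul_le_mul_of_nonneg_left h2 (re_inner_apply_nonneg hp ξ)
      _ = _ := by ring
  have h4 : ‖η‖ ^ 2 ≤ ‖q‖ * (⟪ξ, p ξ⟫_ℂ).re := by
    rcases (sq_nonneg ‖η‖).eq_or_lt with h0 | h0
    · rw [← h0]; exact mul_nonneg (norm_nonneg q) (re_inner_apply_nonneg hp ξ)
    · exact le_of_mul_le_mul_right h3 h0
  have h5 : ⟪ξ, (‖q‖ • p - c * star c) ξ⟫_ℂ = (‖q‖ : ℂ) * ⟪ξ, p ξ⟫_ℂ - (‖η‖ : ℂ) ^ 2 := by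
    rw [sub_apply, inner_sub_right, ← h1, ← Complex.coe_smul, smul_apply, inner_smul_right]
    rfl
  rw [h5]
  change 0 ≤ ((‖q‖ : ℂ) * ⟪ξ, p ξ⟫_ℂ - (‖η‖ : ℂ) ^ 2).re
  rw [Complex.sub_re, Complex.re_ofReal_mul, ← Complex.ofReal_pow, Complex.ofReal_re]
  exact sub_nonneg.2 h4

/-- Testing on a single vector turns the Cauchy–Schwarz hypothesis into a positive quadratic. -/
lemma quadratic_nonneg_of_inner_sq_le (hp : 0 ≤ p) (hq : 0 ≤ q)
    (h : ∀ ξ η, ‖⟪ξ, c η⟫_ℂ‖ ^ 2 ≤ (⟪ξ, p ξ⟫_ℂ).re * (⟪η, q η⟫_ℂ).re) (z : ℂ) :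
    0 ≤ p + z • c + star z • star c + (star z * z) • q := by
  have hsa : IsSelfAdjoint (p + z • c + star z • star c + (star z * z) • q) := by
    have h1 : IsSelfAdjoint (z • c + star z • star c) := by
      rw [← star_smul]; exact .add_star_self _
    rw [add_assoc p]
    exact ((IsSelfAdjoint.of_nonneg hp).add h1).add
      ((IsSelfAdjoint.star_mul_self z).smul (.of_nonneg hq))
  rw [nonneg_iff_isPositive, isPositive_def']
  refine ⟨hsa, fun ξ => ?_⟩
  rw [reApplyInnerSelf_apply, ← inner_re_symm]
  have hstar : ⟪ξ, star c ξ⟫_ℂ = star ⟪ξ, c ξ⟫_ℂ := by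
    rw [star_eq_adjoint, adjoint_inner_right]; exact (inner_conj_symm _ _).symm
  have e : ⟪ξ, (p + z • c + star z • star c + (star z * z) • q) ξ⟫_ℂ =
      ⟪ξ, p ξ⟫_ℂ + z * ⟪ξ, c ξ⟫_ℂ + star (z * ⟪ξ, c ξ⟫_ℂ) + (star z * z) * ⟪ξ, q ξ⟫_ℂ := by
    simp only [add_apply, smul_apply, inner_add_right, inner_smul_right, hstar, star_mul']
  have hw := h ξ ξ
  have h0 := re_inner_apply_nonneg hp ξ
  have h0' := re_inner_apply_nonneg hq ξ
  rw [e]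
  set w := ⟪ξ, c ξ⟫_ℂ
  set x := ⟪ξ, p ξ⟫_ℂ
  set y := ⟪ξ, q ξ⟫_ℂ
  change 0 ≤ (x + z * w + star (z * w) + (star z * z) * y).re
  have e2 : (star z * z : ℂ) = ((‖z‖ ^ 2 : ℝ) : ℂ) := by
    rw [← Complex.normSq_eq_norm_sq]; exact Complex.normSq_eq_conj_mul_self.symm
  have e3 : (star (z * w)).re = (z * w).re := Complex.conj_re _
  rw [e2, Complex.add_re, Complex.add_re, Complex.add_re, Complex.re_ofReal_mul, e3]
  have h1 : -(‖z‖ * ‖w‖) ≤ (z * w).re := by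
    rw [← norm_mul]; exact (abs_le.1 (Complex.abs_re_le_norm _)).1
  have h2 : (2 * (‖z‖ * ‖w‖)) ^ 2 ≤ (x.re + ‖z‖ ^ 2 * y.re) ^ 2 := by
    nlinarith [sq_nonneg (x.re - ‖z‖ ^ 2 * y.re), mul_le_mul_of_nonneg_left hw (sq_nonneg ‖z‖)]
  have h3 := abs_le_of_sq_le_sq h2 (by positivity)
  linarith [le_abs_self (2 * (‖z‖ * ‖w‖))]

end OperatorForms

/-! ### The commutator form in the GNS space -/

section CommutatorForm

open scoped InnerProductSpace ComplexOrder
open PositiveLinearMap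

variable {A : Type*} [CStarAlgebra A] [PartialOrder A] [StarOrderedRing A]
variable {K : Type*} [NormedAddCommGroup K] [InnerProductSpace ℂ K] [CompleteSpace K]

lemma pairFunctional_isTracialMap {Φ : A →ₚ[ℂ] (K →L[ℂ] K)} (hΦ : IsTracialMap Φ) (ξ η : K) :
    IsTracialMap (pairFunctional Φ ξ η) := fun x y => by
  rw [pairFunctional_apply, pairFunctional_apply, hΦ]

/-- On the GNS space of a tracial functional `τ`, the commutator form `ψ ([f(ρ), x]* [g(ρ), y])`
of a tracial functional `ψ` with density `h` is the form of `h * T`, where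
`T = (L_{f(ρ)} - R_{f(ρ)}) (L_{g(ρ)} - R_{g(ρ)})` is built from left and right multiplications.
The operator `T` is positive because `f` and `g` are same monotonic, and it commutes with
the densities of tracial functionals. -/
lemma exists_commutatorForm_operator {τ : A →ₚ[ℂ] ℂ} (hτ : IsTracialMap τ) {ρ : A}
    (hρ : IsSelfAdjoint ρ) {f g : ℝ → ℝ} (hfg : SameMonotonicOn f g (spectrum ℝ ρ)) :
    ∃ (M : VonNeumannAlgebra τ.GNS) (T : τ.GNS →L[ℂ] τ.GNS),
      (∀ x ∈ M, ∀ y ∈ M, x * y = y * x) ∧ T ∈ M ∧ 0 ≤ T ∧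
      ∀ (ψ : A → ℂ) (h : τ.GNS →L[ℂ] τ.GNS), (∀ x y, ψ (x * y) = ψ (y * x)) →
        IsDensity τ ψ h → h ∈ M ∧ ∀ x y,
          ψ (star (cfc f ρ * x - x * cfc f ρ) * (cfc g ρ * y - y * cfc g ρ)) =
            ⟪τ.gnsVec x, (h * T) (τ.gnsVec y)⟫_ℂ := by
  obtain ⟨l, hl_def⟩ : ∃ l, l = τ.gnsStarAlgHom ρ := ⟨_, rfl⟩
  obtain ⟨r, hr_def⟩ : ∃ r, r = gnsRight hτ ρ := ⟨_, rfl⟩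
  have hl : IsSelfAdjoint l := hl_def ▸ hρ.map τ.gnsStarAlgHom
  have hr : IsSelfAdjoint r := hr_def ▸ hρ.map (gnsRight hτ)
  have hlD : spectrum ℝ l ⊆ spectrum ℝ ρ := hl_def ▸
    AlgHom.spectrum_apply_subset (τ.gnsStarAlgHom.toAlgHom.restrictScalars ℝ) ρ
  have hrD : spectrum ℝ r ⊆ spectrum ℝ ρ := hr_def ▸
    AlgHom.spectrum_apply_subset (gnsRight hτ).toAlgHom ρ
  have hcfcl {u : ℝ → ℝ} (hu : ContinuousOn u (spectrum ℝ ρ)) :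
      τ.gnsStarAlgHom (cfc u ρ) = cfc u l := hl_def ▸
    StarAlgHom.map_cfc τ.gnsStarAlgHom u ρ hu (map_continuous _) hρ (hl_def ▸ hl)
  have hcfcr {u : ℝ → ℝ} (hu : ContinuousOn u (spectrum ℝ ρ)) :
      gnsRight hτ (cfc u ρ) = cfc u r := hr_def ▸
    StarAlgHom.map_cfc (gnsRight hτ) u ρ hu (continuous_gnsRight hτ) hρ (hr_def ▸ hr)
  obtain ⟨𝒵, h𝒵⟩ : ∃ 𝒵 : Set (τ.GNS →L[ℂ] τ.GNS), ∀ h, h ∈ 𝒵 ↔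
      ∃ ψ : A → ℂ, (∀ x y, ψ (x * y) = ψ (y * x)) ∧ IsDensity τ ψ h := ⟨{h | _}, fun _ => Iff.rfl⟩
  have h𝒵star : ∀ h ∈ 𝒵, star h ∈ 𝒵 := by
    intro h hh
    obtain ⟨ψ, hψ, hh⟩ := (h𝒵 h).1 hh
    exact (h𝒵 _).2 ⟨_, fun x y => by rw [star_mul, hψ, ← star_mul], hh.star⟩
  have h𝒵l : ∀ h ∈ 𝒵, h * l = l * h := by
    intro h hh
    obtain ⟨ψ, hψ, hh⟩ := (h𝒵 h).1 hh
    rw [hl_def]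
    exact hh.commute_left ρ
  have h𝒵r : ∀ h ∈ 𝒵, h * r = r * h := by
    intro h hh
    obtain ⟨ψ, hψ, hh⟩ := (h𝒵 h).1 hh
    rw [hr_def]
    exact hh.commute_right hτ hψ ρ
  have hlr : l * r = r * l := by
    rw [hl_def, hr_def]
    exact commute_gnsStarAlgHom_gnsRight hτ ρ ρ
  have h𝒵𝒵 : ∀ h ∈ 𝒵, ∀ k ∈ 𝒵, h * k = k * h := by
    intro h hh k hk
    obtain ⟨φ, -, hφ⟩ := (h𝒵 h).1 hh
    obtain ⟨ψ, hψ, hψ'⟩ := (h𝒵 k).1 hk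
    exact hφ.commute hτ hψ hψ'
  obtain ⟨M, hSM, hM⟩ := VonNeumannAlgebra.exists_commutative_of_commuting
    (S := insert l (insert r 𝒵))
    (by
      rintro x (hx | hx | hx)
      · rw [hx, hl.star_eq]; exact .inl rfl
      · rw [hx, hr.star_eq]; exact .inr (.inl rfl)
      · exact .inr (.inr (h𝒵star x hx)))
    (by
      rintro x (hx | hx | hx) y (hy | hy | hy)
      · rw [hx, hy]
      · rw [hx, hy, hlr]
      · rw [hx, h𝒵l y hy]
      · rw [hx, hy, hlr]
      · rw [hx, hy]
      · rw [hx, h𝒵r y hy]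
      · rw [hy, h𝒵l x hx]
      · rw [hy, h𝒵r x hx]
      · exact h𝒵𝒵 x hx y hy)
  obtain ⟨hT0, hTM⟩ := commuting_cfc_sub_mul_cfc_sub_nonneg M hM hfg (hSM (.inl rfl))
    (hSM (.inr (.inl rfl))) hl hr hlD hrD
  refine ⟨M, _, hM, hTM, hT0, fun ψ h hψ hh =>
    ⟨hSM (.inr (.inr ((h𝒵 h).2 ⟨ψ, hψ, hh⟩))), fun x y => ?_⟩⟩
  have hvec {u : ℝ → ℝ} (hu : ContinuousOn u (spectrum ℝ ρ)) (x : A) :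
      τ.gnsVec (cfc u ρ * x - x * cfc u ρ) = (cfc u l - cfc u r) (τ.gnsVec x) := by
    have hsa : star (cfc u ρ) = cfc u ρ := (cfc_predicate u ρ : IsSelfAdjoint _).star_eq
    rw [sub_apply, ← hcfcl hu, ← hcfcr hu, gnsStarAlgHom_gnsVec, gnsRight_gnsVec, hsa, map_sub]
  have hsaD : star (cfc f l - cfc f r) = cfc f l - cfc f r :=
    ((cfc_predicate f l : IsSelfAdjoint _).sub (cfc_predicate f r : IsSelfAdjoint _)).star_eq
  have hcomm : Commute h (cfc f l - cfc f r) := by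
    rw [← hcfcl hfg.1, ← hcfcr hfg.1]
    exact (hh.commute_left _).sub_right (hh.commute_right hτ hψ _)
  rw [← hh, hvec hfg.1, hvec hfg.2.1, ← mul_assoc, hcomm.eq,
    ← ContinuousLinearMap.adjoint_inner_right, ← ContinuousLinearMap.star_eq_adjoint, hsaD]
  rfl

/-- Positivity of the commutator form on pairs of vectors. This uses the two-by-two matrix of
densities of `Φ` with respect to `ξ` and `η`, and is where traciality makes `Φ` behave like a
completely positive map. -/
lemma commutatorForm_inner_sq_le {Φ : A →ₚ[ℂ] (K →L[ℂ] K)} (hΦ : IsTracialMap Φ) {ρ : A}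
    (hρ : IsSelfAdjoint ρ) {f g : ℝ → ℝ} (hfg : SameMonotonicOn f g (spectrum ℝ ρ)) (X Y : A)
    (ξ η : K) :
    0 ≤ ⟪ξ, Φ (star (cfc f ρ * X - X * cfc f ρ) * (cfc g ρ * X - X * cfc g ρ)) ξ⟫_ℂ ∧
    ‖⟪ξ, Φ (star (cfc f ρ * X - X * cfc f ρ) * (cfc g ρ * Y - Y * cfc g ρ)) η⟫_ℂ‖ ^ 2 ≤
      (⟪ξ, Φ (star (cfc f ρ * X - X * cfc f ρ) * (cfc g ρ * X - X * cfc g ρ)) ξ⟫_ℂ).re *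
      (⟪η, Φ (star (cfc f ρ * Y - Y * cfc f ρ) * (cfc g ρ * Y - Y * cfc g ρ)) η⟫_ℂ).re := by
  have hτ := pairFunctional_isTracialMap hΦ ξ η
  obtain ⟨a, b, c, ha0, hb0, hz, ha, hb, hc⟩ := exists_densities Φ ξ η
  obtain ⟨M, T, hM, hTM, hT0, H⟩ := exists_commutatorForm_operator hτ hρ hfg
  have htr (ζ θ : K) (x y : A) : ⟪ζ, Φ (x * y) θ⟫_ℂ = ⟪ζ, Φ (y * x) θ⟫_ℂ := by rw [hΦ]
  obtain ⟨haM, ha⟩ := H _ a (htr ξ ξ) ha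
  obtain ⟨hbM, hb⟩ := H _ b (htr η η) hb
  obtain ⟨hcM, hc⟩ := H _ c (htr ξ η) hc
  rw [ha, hb, hc]
  refine ⟨?_, commuting_inner_sq_le M hM haM hbM hcM hTM ha0 hb0 hT0 hz _ _⟩
  exact ((ContinuousLinearMap.nonneg_iff_isPositive _).1
    (Commute.mul_nonneg ha0 hT0 (hM a haM T hTM))).inner_nonneg_right _

end CommutatorForm

/-! ### Correlation and skew information as commutator forms -/

section Correlation

open scoped InnerProductSpace ComplexOrder

variable {𝒜 ℬ : Type*} [CStarAlgebra 𝒜] [PartialOrder 𝒜] [StarOrderedRing 𝒜]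
  [CStarAlgebra ℬ] [PartialOrder ℬ] [StarOrderedRing ℬ]
  {Φ : 𝒜 →ₚ[ℂ] ℬ} {ρ A B : 𝒜} {f g : ℝ → ℝ}

lemma star_genCorr (hΦ : IsTracialMap Φ) (hA : IsSelfAdjoint A) (hB : IsSelfAdjoint B) :
    star (genCorr Φ ρ f g A B) = genCorr Φ ρ f g B A := by
  have hF : star (cfc f ρ) = cfc f ρ := (cfc_predicate f ρ : IsSelfAdjoint _).star_eq
  have hG : star (cfc g ρ) = cfc g ρ := (cfc_predicate g ρ : IsSelfAdjoint _).star_eq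
  have hFG : cfc f ρ * cfc g ρ = cfc g ρ * cfc f ρ := (cfc_commute_cfc f g ρ).eq
  rw [genCorr, genCorr, star_sub, ← map_star, ← map_star]
  simp only [star_mul, hF, hG, hA.star_eq, hB.star_eq]
  congr 1
  · rw [← mul_assoc, hΦ _ (cfc g ρ * cfc f ρ), hFG, mul_assoc _ B A]
  · rw [← mul_assoc, ← mul_assoc, hΦ _ (cfc f ρ)]
    simp only [mul_assoc]

omit [StarOrderedRing 𝒜] [StarOrderedRing ℬ] in
lemma genCorr_add_genCorr (hΦ : IsTracialMap Φ) (hA : IsSelfAdjoint A) (hB : IsSelfAdjoint B) :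
    genCorr Φ ρ f g A B + genCorr Φ ρ f g B A =
      Φ (star (cfc f ρ * A - A * cfc f ρ) * (cfc g ρ * B - B * cfc g ρ)) := by
  have hF : star (cfc f ρ) = cfc f ρ := (cfc_predicate f ρ : IsSelfAdjoint _).star_eq
  have hFG : cfc f ρ * cfc g ρ = cfc g ρ * cfc f ρ := (cfc_commute_cfc f g ρ).eq
  have hexp : star (cfc f ρ * A - A * cfc f ρ) * (cfc g ρ * B - B * cfc g ρ) =
      A * (cfc f ρ * cfc g ρ * B) - A * (cfc f ρ * B * cfc g ρ) - cfc f ρ * A * cfc g ρ * B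
        + (cfc f ρ * A * B) * cfc g ρ := by
    simp only [star_sub, star_mul, hF, hA.star_eq]
    noncomm_ring
  rw [hexp, map_add, map_sub, map_sub, hΦ A, hΦ A, hΦ _ (cfc g ρ), genCorr, genCorr, hA.star_eq,
    hB.star_eq, ← mul_assoc (cfc g ρ), ← mul_assoc (cfc g ρ), ← hFG]
  abel

lemma realPart_genCorr (hΦ : IsTracialMap Φ) (hA : IsSelfAdjoint A) (hB : IsSelfAdjoint B) :
    (ℜ (genCorr Φ ρ f g A B) : ℬ) = (2⁻¹ : ℝ) •
      Φ (star (cfc f ρ * A - A * cfc f ρ) * (cfc g ρ * B - B * cfc g ρ)) := by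
  rw [realPart_apply_coe, star_genCorr hΦ hA hB, genCorr_add_genCorr hΦ hA hB]

omit [StarOrderedRing 𝒜] [StarOrderedRing ℬ] in
lemma skewInfo_eq (hΦ : IsTracialMap Φ) (hA : IsSelfAdjoint A) :
    skewInfo Φ ρ f g A = (2⁻¹ : ℝ) •
      Φ (star (cfc f ρ * A - A * cfc f ρ) * (cfc g ρ * A - A * cfc g ρ)) := by
  rw [← genCorr_add_genCorr hΦ hA hA, ← two_smul ℝ (genCorr Φ ρ f g A A), smul_smul,
    inv_mul_cancel₀ two_ne_zero, one_smul, skewInfo]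

end Correlation

/-! ### Maps into a von Neumann algebra -/

section Inclusion
open scoped InnerProductSpace ComplexOrder

variable {A : Type*} [CStarAlgebra A] [PartialOrder A] [StarOrderedRing A]
variable {K : Type*} [NormedAddCommGroup K] [InnerProductSpace ℂ K] [CompleteSpace K]

/-- A positive map into a von Neumann algebra, regarded as a map into the bounded operators. -/
noncomputable def PositiveLinearMap.toOperators {ℬ : VonNeumannAlgebra K} (Φ : A →ₚ[ℂ] ℬ) :
    A →ₚ[ℂ] (K →L[ℂ] K) :=
  PositiveLinearMap.mk₀
    { toFun := fun x => (Φ x : K →L[ℂ] K)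
      map_add' := fun x y => by rw [map_add]; rfl
      map_smul' := fun c x => by rw [map_smul]; rfl }
    fun _ hx => Φ.map_nonneg hx

/-- By `commutatorForm_inner_sq_le` the matrix with rows `(p, c)` and `(star c, q)` is positive. The
first conclusion follows by testing on vectors, the second because `p`, `q`, `c` lie in a
commutative von Neumann algebra. -/
lemma commutatorForm_inequalities {ℬ : VonNeumannAlgebra K} {Φ : A →ₚ[ℂ] ℬ}
    (hΦ : IsTracialMap Φ) {ρ : A} (hρ : IsSelfAdjoint ρ) {f g : ℝ → ℝ}
    (hfg : SameMonotonicOn f g (spectrum ℝ ρ)) (X Y : A) {p q c : ℬ}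
    (hp : p = Φ (star (cfc f ρ * X - X * cfc f ρ) * (cfc g ρ * X - X * cfc g ρ)))
    (hq : q = Φ (star (cfc f ρ * Y - Y * cfc f ρ) * (cfc g ρ * Y - Y * cfc g ρ)))
    (hc : c = Φ (star (cfc f ρ * X - X * cfc f ρ) * (cfc g ρ * Y - Y * cfc g ρ)))
    (hcsa : IsSelfAdjoint c) :
    star c * c ≤ ‖q‖ • p ∧ ((∀ X Y : A, Commute (Φ X) (Φ Y)) → star c * c ≤ p * q) := by
  have hΨ : IsTracialMap Φ.toOperators := fun x y => congrArg Subtype.val (hΦ x y)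
  have H (U V : A) := commutatorForm_inner_sq_le hΨ hρ hfg U V
  have hnn (U : A) : (0 : K →L[ℂ] K) ≤ Φ.toOperators
      (star (cfc f ρ * U - U * cfc f ρ) * (cfc g ρ * U - U * cfc g ρ)) := by
    rw [ContinuousLinearMap.nonneg_iff_isPositive, ContinuousLinearMap.isPositive_iff_complex]
    intro ξ
    have h0 := (H U U ξ ξ).1
    rw [← inner_conj_symm, show starRingEnd ℂ _ = _ from (IsSelfAdjoint.of_nonneg h0).star_eq]
    exact ⟨(Complex.eq_re_of_ofReal_le h0).symm, (Complex.le_def.1 h0).1⟩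
  have hp0 : (0 : K →L[ℂ] K) ≤ p := hp ▸ hnn X
  have hq0 : (0 : K →L[ℂ] K) ≤ q := hq ▸ hnn Y
  have hform : ∀ ξ η, ‖⟪ξ, (c : K →L[ℂ] K) η⟫_ℂ‖ ^ 2 ≤
      (⟪ξ, (p : K →L[ℂ] K) ξ⟫_ℂ).re * (⟪η, (q : K →L[ℂ] K) η⟫_ℂ).re := fun ξ η => by
    rw [hp, hq, hc]
    exact (H X Y ξ η).2
  have hcsa' : IsSelfAdjoint (c : K →L[ℂ] K) := congrArg Subtype.val hcsa
  constructor
  · have := mul_star_self_le_norm_smul hp0 hform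
    rw [hcsa'.star_eq] at this
    rw [hcsa.star_eq]
    exact this
  · intro hcomm
    have hS : ∀ x ∈ Set.range (fun x => (Φ x : K →L[ℂ] K)),
        star x ∈ Set.range (fun x => (Φ x : K →L[ℂ] K)) := by
      rintro _ ⟨x, rfl⟩
      exact ⟨star x, congrArg Subtype.val (map_star Φ x)⟩
    obtain ⟨M, hSM, hM⟩ := VonNeumannAlgebra.exists_commutative_of_commuting hS (by
      rintro _ ⟨x, rfl⟩ _ ⟨y, rfl⟩
      exact congrArg Subtype.val (hcomm x y).eq)
    exact commuting_star_mul_self_le_mul M hM (hSM ⟨_, congrArg Subtype.val hp.symm⟩)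
      (hSM ⟨_, congrArg Subtype.val hq.symm⟩) (hSM ⟨_, congrArg Subtype.val hc.symm⟩) hp0 hq0
      (quadratic_nonneg_of_inner_sq_le hp0 hq0 hform)

end Inclusion

/-! ### Scaling of the inequalities -/

section Scaling

variable {ℬ : Type*} [CStarAlgebra ℬ] [PartialOrder ℬ] [StarOrderedRing ℬ] {p q c : ℬ} {t : ℝ}

lemma star_smul_mul_smul_le_norm_smul (ht : 0 ≤ t) (h : star c * c ≤ ‖q‖ • p) :
    star (t • c) * (t • c) ≤ ‖t • q‖ • t • p := by
  rw [star_smul, star_trivial, smul_mul_smul_comm, norm_smul, Real.norm_of_nonneg ht, smul_smul,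
    mul_right_comm, mul_smul (t * t)]
  exact smul_le_smul_of_nonneg_left h (mul_nonneg ht ht)

lemma star_smul_mul_smul_le_mul (ht : 0 ≤ t) (h : star c * c ≤ p * q) :
    star (t • c) * (t • c) ≤ (t • p) * (t • q) := by
  rw [star_smul, star_trivial, smul_mul_smul_comm, smul_mul_smul_comm]
  exact smul_le_smul_of_nonneg_left h (mul_nonneg ht ht)

end Scaling

theorem mainTheorem6
    {H K : Type*}
    [NormedAddCommGroup H] [InnerProductSpace ℂ H] [CompleteSpace H]
    [NormedAddCommGroup K] [InnerProductSpace ℂ K] [CompleteSpace K]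
    (𝒜 : VonNeumannAlgebra H) (ℬ : VonNeumannAlgebra K)
    (Φ : 𝒜 →ₚ[ℂ] ℬ) (hΦ : IsTracialMap Φ)
    (ρ : 𝒜) (hρ : IsSelfAdjoint ρ)
    (f g : ℝ → ℝ) (hfg : SameMonotonicOn f g (spectrum ℝ ρ))
    (A B : 𝒜) (hA : IsSelfAdjoint A) (hB : IsSelfAdjoint B) :
    CFC.abs (ℜ (genCorr Φ ρ f g A B) : ℬ) ^ 2 ≤
        ‖skewInfo Φ ρ f g B‖ • skewInfo Φ ρ f g A ∧
      ((∀ X Y : 𝒜, Commute (Φ X) (Φ Y)) →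
        CFC.abs (ℜ (genCorr Φ ρ f g A B) : ℬ) ^ 2 ≤
          skewInfo Φ ρ f g A * skewInfo Φ ρ f g B) := by
  have hre := realPart_genCorr (f := f) (g := g) (ρ := ρ) hΦ hA hB
  have hsa : IsSelfAdjoint (Φ (star (cfc f ρ * A - A * cfc f ρ) *
      (cfc g ρ * B - B * cfc g ρ))) := by
    rw [← genCorr_add_genCorr hΦ hA hB, ← star_genCorr hΦ hA hB]
    exact .add_star_self _
  obtain ⟨h1, h2⟩ := commutatorForm_inequalities hΦ hρ hfg A B rfl rfl rfl hsa
  have half_nonneg : (0 : ℝ) ≤ 2⁻¹ := by norm_num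
  rw [CFC.abs_sq, hre, skewInfo_eq hΦ hA, skewInfo_eq hΦ hB]
  exact ⟨star_smul_mul_smul_le_norm_smul half_nonneg h1,
    fun hcomm => star_smul_mul_smul_le_mul half_nonneg (h2 hcomm)⟩
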